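/- Let $W=(W(t))_{t\ge 0}$ be a standard Brownian motion on the real line with $W(0)=0$, and for $\varepsilon>0$ and $T>0$ let $$V_{\varepsilon,T}=\frac{1}{\varepsilon\sqrt T}\,\mathrm{Leb}\{t\in[0,T] : |W(t)|\le \varepsilon/2\},$$ where $\mathrm{Leb}$ is Lebesgue measure. Let $N$ be a standard normal random variable. Then: 1. For every fixed $T>0$, $V_{\varepsilon,T}$ converges in distribution to $|N|$ as $\varepsilon\to0^+$; the same convergence holds as $\varepsilon\to0^+$ and $T\to\infty$ jointly. 2. For every integer $p\ge0$, the moment $E\,V_{\varepsilon,T}^p$ is finite for all $\varepsilon,T>0$, and $$E\,V_{\varepsilon,T}^p\longrightarrow \frac{p!}{2^{p/2}\,\Gamma(p/2+1)}$$ as $\varepsilon\to0^+$ for every fixed $T>0$, and also as $\varepsilon\to0^+$ and $T\to\infty$ jointly. 3. These limits are the moments of $|N|$: for every integer $p\ge 0$, $E|N|^p$ is finite and $E|N|^p=\dfrac{p!}{2^{p/2}\,\Gamma(p/2+1)}$. -/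

import Mathlib

open MeasureTheory ProbabilityTheory Filter Topology
open scoped NNReal

/-- The relative time that the path `w` spends along the time axis during `[0, T]`, in the strip
of width `ε`: Lebesgue measure of `{t ∈ [0, T] : |w t| ≤ ε / 2}`, divided by `ε √T`.
Time is a variable of type `ℝ` here, so that the measure is Lebesgue measure on the line. -/
noncomputable def relativeTime (w : ℝ≥0 → ℝ) (ε T : ℝ) : ℝ :=
  (ε * √T)⁻¹ * volume.real {t : ℝ | t ∈ Set.Icc 0 T ∧ |w t.toNNReal| ≤ ε / 2}

/-- The limiting `p`-th moment `p! / (2 ^ (p / 2) Γ(p / 2 + 1))`. -/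
noncomputable def limitMoment (p : ℕ) : ℝ :=
  (p.factorial : ℝ) / ((2 : ℝ) ^ ((p : ℝ) / 2) * Real.Gamma ((p : ℝ) / 2 + 1))

open scoped ENNReal

/-! The proof is by the method of moments. Let `A t` be the time spent in the strip until `t`.
Ordering the times in a power of an integral gives `A t ^ (p + 1) = (p + 1) ∫₀ᵗ 1{W s in strip} A s
^ p ds`. The increment after `r` is independent of the path until `r`, so given that `W r` is in the
strip, `W s` is there with probability between `ε g(s - r, ε)` and `ε g(s - r, 0)`, where `g(v, ·)`
is the centred Gaussian density of variance `v`. Iterating, the `(p + 1)`-st moment of `A 1 / ε`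
lies between `(p + 1)!` times the integrals over `(0, 1]` of `kernelPow ε p` and `kernelPow 0 p`.

The upper kernel is a convolution power of `(2πs)^(-1/2)`; Beta integrals turn the upper bound into
exactly `limitMoment (p + 1)`. By dominated convergence the lower bound tends to it as `ε → 0`.
Brownian scaling replaces `(ε, T)` by `(ε / √T, 1)`, so both regimes reduce to `ε / √T → 0`.

Since `limitMoment` gives the moments of `|N|`, which has all exponential moments, the nonasymptotic
upper bound dominates the series of the characteristic functions, and Lévy's theorem gives
convergence in distribution. -/

/-! ### Powers of an integral through ordered times -/

lemma setLIntegral_Ioc_mul_setLIntegral_Ioc {f g : ℝ → ℝ≥0∞} (hf : Measurable f)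
    (hg : Measurable g) (t : ℝ) :
    ∫⁻ s in Set.Ioc 0 t, g s * ∫⁻ u in Set.Ioc s t, f u =
      ∫⁻ u in Set.Ioc 0 t, f u * ∫⁻ s in Set.Ioc 0 u, g s := by
  have h1 : ∀ s ∈ Set.Ioc 0 t, g s * ∫⁻ u in Set.Ioc s t, f u =
      ∫⁻ u in Set.Ioc 0 t, {q : ℝ × ℝ | q.1 < q.2}.indicator (fun q ↦ g q.1 * f q.2) (s, u) := by
    intro s hs
    rw [← lintegral_const_mul _ hf]
    have : Set.Ioc s t = Set.Ioi s ∩ Set.Ioc 0 t := by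
      ext x; simp only [Set.mem_Ioc, Set.mem_inter_iff, Set.mem_Ioi] at *; grind
    rw [this, ← Measure.restrict_restrict measurableSet_Ioi, ← lintegral_indicator measurableSet_Ioi]
    rfl
  have h2 : ∀ u ∈ Set.Ioc 0 t, f u * ∫⁻ s in Set.Ioc 0 u, g s =
      ∫⁻ s in Set.Ioc 0 t, {q : ℝ × ℝ | q.1 < q.2}.indicator (fun q ↦ g q.1 * f q.2) (s, u) := by
    intro u hu
    rw [← lintegral_const_mul _ hg, ← restrict_Ioo_eq_restrict_Ioc]
    have : Set.Ioo 0 u = Set.Iio u ∩ Set.Ioc 0 t := by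
      ext x; simp only [Set.mem_Ioc, Set.mem_inter_iff, Set.mem_Iio, Set.mem_Ioo] at *; grind
    rw [this, ← Measure.restrict_restrict measurableSet_Iio, ← lintegral_indicator measurableSet_Iio]
    simp_rw [mul_comm (f u)]
    rfl
  rw [setLIntegral_congr_fun measurableSet_Ioc h1, setLIntegral_congr_fun measurableSet_Ioc h2,
    lintegral_lintegral_swap]
  refine Measurable.aemeasurable (Measurable.indicator ?_ ?_)
  · fun_prop
  · exact measurableSet_lt measurable_fst measurable_snd

lemma measurable_setLIntegral_Ioc_zero {f : ℝ → ℝ≥0∞} :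
    Measurable fun s ↦ ∫⁻ u in Set.Ioc 0 s, f u :=
  Monotone.measurable fun _ _ hst ↦ lintegral_mono_set (Set.Ioc_subset_Ioc_right hst)

/-- Any of the `p + 1` times may be the largest one, `s`. The induction splits the extra factor at
`s` and applies Tonelli to the part after `s`; neither finiteness nor differentiability is needed.
-/
lemma setLIntegral_Ioc_pow_succ {f : ℝ → ℝ≥0∞} (hf : Measurable f) (p : ℕ) (t : ℝ) :
    (∫⁻ s in Set.Ioc 0 t, f s) ^ (p + 1) =
      (p + 1) * ∫⁻ s in Set.Ioc 0 t, f s * (∫⁻ r in Set.Ioc 0 s, f r) ^ p := by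
  have hF := measurable_setLIntegral_Ioc_zero (f := f)
  induction p generalizing t with
  | zero => simp
  | succ p ih =>
    have hm : Measurable fun s ↦ f s * (∫⁻ r in Set.Ioc 0 s, f r) ^ p := by fun_prop
    have split : ∀ s ∈ Set.Ioc 0 t, f s * (∫⁻ r in Set.Ioc 0 s, f r) ^ p * ∫⁻ u in Set.Ioc 0 t, f u
        = f s * (∫⁻ r in Set.Ioc 0 s, f r) ^ (p + 1) +
          f s * (∫⁻ r in Set.Ioc 0 s, f r) ^ p * ∫⁻ u in Set.Ioc s t, f u := by
      intro s hs
      rw [← Set.Ioc_union_Ioc_eq_Ioc hs.1.le hs.2,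
        lintegral_union measurableSet_Ioc (Set.Ioc_disjoint_Ioc_of_le le_rfl)]
      ring
    rw [pow_succ, ih, mul_assoc, ← lintegral_mul_const _ hm,
      setLIntegral_congr_fun measurableSet_Ioc split, lintegral_add_left (by fun_prop),
      setLIntegral_Ioc_mul_setLIntegral_Ioc hf hm, mul_add]
    have second : (p + 1 : ℝ≥0∞) * ∫⁻ u in Set.Ioc 0 t, f u * ∫⁻ s in Set.Ioc 0 u,
        f s * (∫⁻ r in Set.Ioc 0 s, f r) ^ p =
        ∫⁻ s in Set.Ioc 0 t, f s * (∫⁻ r in Set.Ioc 0 s, f r) ^ (p + 1) := by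
      have hint : Measurable fun u ↦ f u * ∫⁻ s in Set.Ioc 0 u,
          f s * (∫⁻ r in Set.Ioc 0 s, f r) ^ p := hf.mul measurable_setLIntegral_Ioc_zero
      rw [← lintegral_const_mul _ hint]
      simp_rw [mul_left_comm _ (f _), ← ih]
    rw [second]
    push_cast
    ring

/-! ### Gaussian mass of a strip -/

lemma gaussianPDF_zero_le_of_abs_le {v : ℝ≥0} {x y : ℝ} (h : |x| ≤ |y|) :
    gaussianPDF 0 v y ≤ gaussianPDF 0 v x := by
  refine ENNReal.ofReal_le_ofReal ?_
  have := sq_le_sq.2 h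
  simp only [gaussianPDFReal, sub_zero]
  gcongr

lemma setOf_abs_add_le_eq_Icc (y ε : ℝ) :
    {z : ℝ | |y + z| ≤ ε / 2} = Set.Icc (-(ε / 2) - y) (ε / 2 - y) := by
  ext z
  simp only [Set.mem_ofPred_eq, abs_le, Set.mem_Icc]
  grind

/-- Two points of the strip are at most `ε` apart, so on a window of length `ε` the density is at
least its value at `ε`. -/
lemma le_gaussianReal_strip {v : ℝ≥0} (hv : v ≠ 0) {y ε : ℝ} (hy : |y| ≤ ε / 2) :
    ENNReal.ofReal ε * gaussianPDF 0 v ε ≤ gaussianReal 0 v {z | |y + z| ≤ ε / 2} := by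
  rw [gaussianReal_apply _ hv, setOf_abs_add_le_eq_Icc]
  have hb := abs_le.1 hy
  calc _ = ∫⁻ _ in Set.Icc (-(ε / 2) - y) (ε / 2 - y), gaussianPDF 0 v ε := by
        rw [setLIntegral_const, Real.volume_Icc, mul_comm]
        congr 2
        ring
    _ ≤ _ := setLIntegral_mono (measurable_gaussianPDF 0 v) fun x hx ↦
        gaussianPDF_zero_le_of_abs_le <| by
          rw [abs_of_nonneg (by linarith : 0 ≤ ε), abs_le]
          constructor <;> linarith [hx.1, hx.2]

lemma gaussianReal_strip_le {v : ℝ≥0} (hv : v ≠ 0) (y ε : ℝ) :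
    gaussianReal 0 v {z | |y + z| ≤ ε / 2} ≤ ENNReal.ofReal ε * gaussianPDF 0 v 0 := by
  rw [gaussianReal_apply _ hv, setOf_abs_add_le_eq_Icc]
  calc _ ≤ ∫⁻ _ in Set.Icc (-(ε / 2) - y) (ε / 2 - y), gaussianPDF 0 v 0 :=
        setLIntegral_mono measurable_const fun x _ ↦ gaussianPDF_zero_le_of_abs_le (by simp)
    _ = _ := by
        rw [setLIntegral_const, Real.volume_Icc, mul_comm]
        congr 2
        ring

/-! ### Occupation time and the Markov property -/

section Occupation

variable {Ω : Type*} {mΩ : MeasurableSpace Ω} {P : Measure Ω} {W : ℝ≥0 → Ω → ℝ}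

/-- The indicator that the path `w` is in the closed strip of width `ε` at time `s`. -/
noncomputable def inStrip (w : ℝ≥0 → ℝ) (ε s : ℝ) : ℝ≥0∞ :=
  {x : ℝ | |x| ≤ ε / 2}.indicator 1 (w s.toNNReal)

/-- The time that the path `w` spends in the closed strip of width `ε` during `(0, t]`. -/
noncomputable def occupationTime (w : ℝ≥0 → ℝ) (ε t : ℝ) : ℝ≥0∞ :=
  ∫⁻ s in Set.Ioc 0 t, inStrip w ε s

lemma measurableSet_strip (ε : ℝ) : MeasurableSet {x : ℝ | |x| ≤ ε / 2} :=
  measurableSet_le (by fun_prop) (by fun_prop)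

lemma measurable_inStrip_uncurry (hc : ∀ ω, Continuous (W · ω)) (hm : ∀ t, Measurable (W t))
    (ε : ℝ) : Measurable fun q : ℝ × Ω ↦ inStrip (W · q.2) ε q.1 := by
  have h : Measurable (Function.uncurry fun (t : ℝ) (ω : Ω) ↦ W t.toNNReal ω) :=
    measurable_uncurry_of_continuous_of_measurable
      (fun ω ↦ (hc ω).comp continuous_real_toNNReal) fun t ↦ hm _
  exact (measurable_one.indicator (measurableSet_strip ε)).comp h

lemma measurable_inStrip (hm : ∀ t, Measurable (W t)) (ε s : ℝ) :
    Measurable fun ω ↦ inStrip (W · ω) ε s :=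
  (measurable_one.indicator (measurableSet_strip ε)).comp (hm _)

lemma measurable_inStrip_path (hc : ∀ ω, Continuous (W · ω)) (ε : ℝ) (ω : Ω) :
    Measurable (inStrip (W · ω) ε) :=
  (measurable_one.indicator (measurableSet_strip ε)).comp
    ((hc ω).comp continuous_real_toNNReal).measurable

lemma measurable_occupationTime_uncurry (hc : ∀ ω, Continuous (W · ω))
    (hm : ∀ t, Measurable (W t)) (ε : ℝ) :
    Measurable fun q : ℝ × Ω ↦ occupationTime (W · q.2) ε q.1 := by
  have h : Measurable fun x : (ℝ × Ω) × ℝ ↦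
      {x : (ℝ × Ω) × ℝ | x.2 ∈ Set.Ioc 0 x.1.1}.indicator
        (fun x ↦ inStrip (W · x.1.2) ε x.2) x := by
    refine Measurable.indicator ?_ ?_
    · exact (measurable_inStrip_uncurry hc hm ε).comp (measurable_snd.prodMk (by fun_prop))
    · exact (measurableSet_lt measurable_const measurable_snd).inter
        (measurableSet_le measurable_snd (by fun_prop))
  convert Measurable.lintegral_prod_right' (ν := volume) h using 2 with q
  rw [occupationTime, ← lintegral_indicator measurableSet_Ioc]
  rfl

lemma measurable_occupationTime (hc : ∀ ω, Continuous (W · ω)) (hm : ∀ t, Measurable (W t))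
    (ε t : ℝ) : Measurable fun ω ↦ occupationTime (W · ω) ε t :=
  (measurable_occupationTime_uncurry hc hm ε).comp measurable_prodMk_left

/-- The occupation time until `r` is a functional of the path until `r`. -/
lemma measurable_occupationTime_comap (hc : ∀ ω, Continuous (W · ω)) (ε : ℝ) (r : ℝ≥0) :
    Measurable[MeasurableSpace.comap (fun ω (t : Set.Iic r) ↦ W t ω) inferInstance]
      fun ω ↦ occupationTime (W · ω) ε r := by
  let m : MeasurableSpace Ω :=
    MeasurableSpace.comap (fun ω (t : Set.Iic r) ↦ W t ω) inferInstance
  -- Freezing the path at time `r` leaves the occupation time until `r` unchanged, and every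
  -- marginal of the frozen process is measurable for the past of `r`.
  have h := @measurable_occupationTime Ω m (fun t ω ↦ W (min t r) ω)
    (fun ω ↦ (hc ω).comp (by fun_prop)) (fun t ↦
      (measurable_pi_apply (⟨min t r, min_le_right t r⟩ : Set.Iic r)).comp
        (comap_measurable (fun ω (t : Set.Iic r) ↦ W t ω))) ε r
  convert h using 2 with ω
  refine setLIntegral_congr_fun measurableSet_Ioc fun s hs ↦ ?_
  have : min s.toNNReal r = s.toNNReal := min_eq_left (Real.toNNReal_le_iff_le_coe.2 hs.2)
  simp [inStrip, this]

/-- Markov property at time `r`: the increment to `s` is independent of the pair `(W r, X)` and has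
variance `s - r`, so it can be integrated out first under the product law. -/
lemma lintegral_inStrip_mul_inStrip_mul (hW : IsPreBrownianReal W P) [IsProbabilityMeasure P]
    (hm : ∀ t, Measurable (W t)) {r s : ℝ} (hr : 0 ≤ r) (hrs : r < s) (ε : ℝ) {X : Ω → ℝ≥0∞}
    (hX : Measurable[MeasurableSpace.comap (fun ω (t : Set.Iic r.toNNReal) ↦ W t ω)
      inferInstance] X) :
    ∫⁻ ω, inStrip (W · ω) ε s * (inStrip (W · ω) ε r * X ω) ∂P =
      ∫⁻ ω, inStrip (W · ω) ε r * X ω *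
        gaussianReal 0 (s - r).toNNReal {z | |W r.toNNReal ω + z| ≤ ε / 2} ∂P := by
  have hXm : Measurable X := hX.mono
    (measurable_pi_iff.2 fun t : Set.Iic r.toNNReal ↦ hm t).comap_le le_rfl
  have hsr : s.toNNReal = r.toNNReal + (s - r).toNNReal := by
    rw [← Real.toNNReal_add hr (by linarith)]
    congr 1
    ring
  have hY : Measurable[MeasurableSpace.comap (fun ω (t : Set.Iic r.toNNReal) ↦ W t ω)
      inferInstance] fun ω ↦ (W r.toNNReal ω, X ω) :=
    ((measurable_pi_apply (⟨r.toNNReal, Set.self_mem_Iic⟩ : Set.Iic r.toNNReal)).comp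
        (comap_measurable (fun ω (t : Set.Iic r.toNNReal) ↦ W t ω))).prodMk hX
  have hind : IndepFun (fun ω ↦ W (r.toNNReal + (s - r).toNNReal) ω - W r.toNNReal ω)
      (fun ω ↦ (W r.toNNReal ω, X ω)) P := by
    have h1 := (hW.indepFun_shift r.toNNReal).comp
      (measurable_pi_apply (s - r).toNNReal) measurable_id
    exact indep_of_indep_of_le_right h1 hY.comap_le
  rw [← hsr] at hind
  have hYm : Measurable fun ω ↦ (W r.toNNReal ω, X ω) := (hm _).prodMk hXm
  have hZm : Measurable fun ω ↦ W s.toNNReal ω - W r.toNNReal ω := (hm _).sub (hm _)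
  have hZ : P.map (fun ω ↦ W s.toNNReal ω - W r.toNNReal ω) =
      gaussianReal 0 (s - r).toNNReal := by
    have h2 := ((hW.shift r.toNNReal).hasLaw_eval (s - r).toNNReal).map_eq
    rwa [← hsr] at h2
  let S := {x : ℝ | |x| ≤ ε / 2}
  have hS : MeasurableSet S := measurableSet_strip ε
  let φ : (ℝ × ℝ≥0∞) × ℝ → ℝ≥0∞ := fun q ↦
    S.indicator 1 q.1.1 * q.1.2 * S.indicator 1 (q.1.1 + q.2)
  have hI : Measurable (S.indicator (1 : ℝ → ℝ≥0∞)) := measurable_one.indicator hS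
  have hφ : Measurable φ := by
    refine ((hI.comp (by fun_prop)).mul (by fun_prop)).mul (hI.comp (by fun_prop))
  have hjoint := (indepFun_iff_map_prod_eq_prod_map_map hYm.aemeasurable hZm.aemeasurable).1
    hind.symm
  calc _ = ∫⁻ ω, φ ((W r.toNNReal ω, X ω), W s.toNNReal ω - W r.toNNReal ω) ∂P := by
        refine lintegral_congr fun ω ↦ ?_
        simp only [φ, inStrip, S, add_sub_cancel]
        ring
    _ = ∫⁻ q, φ q ∂((P.map fun ω ↦ (W r.toNNReal ω, X ω)).prod
          (gaussianReal 0 (s - r).toNNReal)) := by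
        rw [← hZ, ← hjoint, lintegral_map hφ (hYm.prodMk hZm)]
    _ = ∫⁻ y, S.indicator 1 y.1 * y.2 * gaussianReal 0 (s - r).toNNReal {z | y.1 + z ∈ S}
          ∂(P.map fun ω ↦ (W r.toNNReal ω, X ω)) := by
        rw [lintegral_prod _ hφ.aemeasurable]
        refine lintegral_congr fun y ↦ ?_
        simp only [φ]
        have hIy : Measurable fun z ↦ S.indicator (1 : ℝ → ℝ≥0∞) (y.1 + z) :=
          hI.comp (measurable_const_add y.1)
        rw [lintegral_const_mul _ hIy]
        congr 1
        exact lintegral_indicator_one ((measurable_const_add y.1) hS)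
    _ = _ := by
        rw [lintegral_map _ hYm]
        · rfl
        · refine ((hI.comp (by fun_prop)).mul (by fun_prop)).mul ?_
          exact (measurable_measure_prodMk_left (ν := gaussianReal 0 (s - r).toNNReal)
            (s := {q : ℝ × ℝ | q.1 + q.2 ∈ S}) ((by fun_prop : Measurable fun q : ℝ × ℝ ↦
              q.1 + q.2) hS)).comp measurable_fst

lemma lintegral_inStrip_mul_inStrip_mul_le (hW : IsPreBrownianReal W P) [IsProbabilityMeasure P]
    (hm : ∀ t, Measurable (W t)) {r s : ℝ} (hr : 0 ≤ r) (hrs : r < s) (ε : ℝ) {X : Ω → ℝ≥0∞}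
    (hX : Measurable[MeasurableSpace.comap (fun ω (t : Set.Iic r.toNNReal) ↦ W t ω)
      inferInstance] X) :
    ∫⁻ ω, inStrip (W · ω) ε s * (inStrip (W · ω) ε r * X ω) ∂P ≤
      ENNReal.ofReal ε * gaussianPDF 0 (s - r).toNNReal 0 *
        ∫⁻ ω, inStrip (W · ω) ε r * X ω ∂P := by
  have hv : (s - r).toNNReal ≠ 0 := by simpa using hrs
  rw [lintegral_inStrip_mul_inStrip_mul hW hm hr hrs ε hX, ← lintegral_const_mul']
  · refine lintegral_mono fun ω ↦ ?_
    rw [mul_comm]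
    exact mul_le_mul_left (gaussianReal_strip_le hv _ ε) _
  · exact ENNReal.mul_ne_top ENNReal.ofReal_ne_top gaussianPDF_ne_top

lemma le_lintegral_inStrip_mul_inStrip_mul (hW : IsPreBrownianReal W P) [IsProbabilityMeasure P]
    (hm : ∀ t, Measurable (W t)) {r s : ℝ} (hr : 0 ≤ r) (hrs : r < s) (ε : ℝ) {X : Ω → ℝ≥0∞}
    (hX : Measurable[MeasurableSpace.comap (fun ω (t : Set.Iic r.toNNReal) ↦ W t ω)
      inferInstance] X) :
    ENNReal.ofReal ε * gaussianPDF 0 (s - r).toNNReal ε *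
        ∫⁻ ω, inStrip (W · ω) ε r * X ω ∂P ≤
      ∫⁻ ω, inStrip (W · ω) ε s * (inStrip (W · ω) ε r * X ω) ∂P := by
  have hv : (s - r).toNNReal ≠ 0 := by simpa using hrs
  rw [lintegral_inStrip_mul_inStrip_mul hW hm hr hrs ε hX, ← lintegral_const_mul']
  · refine lintegral_mono fun ω ↦ ?_
    -- The lower bound needs the starting point in the strip; elsewhere the indicator at time `r`
    -- vanishes.
    by_cases h : |W r.toNNReal ω| ≤ ε / 2
    · rw [mul_comm]
      exact mul_le_mul_right (le_gaussianReal_strip hv h) _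
    · simp [inStrip, h]
  · exact ENNReal.mul_ne_top ENNReal.ofReal_ne_top gaussianPDF_ne_top

end Occupation

/-! ### Convolution powers of the heat kernel -/

/-- Convolution powers on the half-line of the Gaussian heat kernel evaluated at the distance `ε`. -/
noncomputable def kernelPow (ε : ℝ) : ℕ → ℝ → ℝ≥0∞
  | 0, s => gaussianPDF 0 s.toNNReal ε
  | p + 1, s => ∫⁻ r in Set.Ioc 0 s, gaussianPDF 0 (s - r).toNNReal ε * kernelPow ε p r

/-- The substitution `r = s x` reduces this to the normalisation of the Beta density. -/
lemma lintegral_Ioc_rpow_mul_rpow {α β s : ℝ} (hα : 0 < α) (hβ : 0 < β) (hs : 0 < s) :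
    ∫⁻ r in Set.Ioc 0 s, ENNReal.ofReal ((s - r) ^ (β - 1) * r ^ (α - 1)) =
      ENNReal.ofReal (beta α β * s ^ (α + β - 1)) := by
  have hb := beta_pos hα hβ
  have himg : (fun x ↦ s * x) '' Set.Ioo 0 1 = Set.Ioo 0 s := by
    rw [Set.image_mul_left_Ioo hs]; simp
  rw [← restrict_Ioo_eq_restrict_Ioc, ← himg,
    lintegral_image_eq_lintegral_abs_deriv_mul measurableSet_Ioo (f' := fun _ ↦ s)
      (fun x _ ↦ by simpa using ((hasDerivAt_id x).const_mul s).hasDerivWithinAt)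
      (fun x _ y _ h ↦ mul_left_cancel₀ hs.ne' h)]
  have key : ∀ x ∈ Set.Ioo (0 : ℝ) 1,
      ENNReal.ofReal |s| * ENNReal.ofReal ((s - s * x) ^ (β - 1) * (s * x) ^ (α - 1)) =
      ENNReal.ofReal (beta α β * s ^ (α + β - 1)) *
        ENNReal.ofReal (1 / beta α β * x ^ (α - 1) * (1 - x) ^ (β - 1)) := by
    intro x hx
    rw [← ENNReal.ofReal_mul (abs_nonneg s), ← ENNReal.ofReal_mul (by positivity), abs_of_pos hs]
    congr 1
    rw [show s - s * x = s * (1 - x) by ring, Real.mul_rpow hs.le (by linarith [hx.2]),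
      Real.mul_rpow hs.le hx.1.le,
      show α + β - 1 = 1 + (β - 1) + (α - 1) by ring, Real.rpow_add hs, Real.rpow_add hs,
      Real.rpow_one]
    field_simp
  rw [setLIntegral_congr_fun measurableSet_Ioo key, lintegral_const_mul' _ _ ENNReal.ofReal_ne_top,
    ← lintegral_betaPDF, lintegral_betaPDF_eq_one hα hβ, mul_one]

lemma gaussianPDF_zero_apply_zero {s : ℝ} (hs : 0 < s) :
    gaussianPDF 0 s.toNNReal 0 = ENNReal.ofReal ((√(2 * Real.pi))⁻¹ * s ^ ((1 : ℝ) / 2 - 1)) := by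
  rw [gaussianPDF, gaussianPDFReal, Real.coe_toNNReal _ hs.le, Real.sqrt_mul (by positivity)]
  congr 1
  rw [show (1 : ℝ) / 2 - 1 = -(1 / 2) by norm_num, Real.rpow_neg hs.le, ← Real.sqrt_eq_rpow]
  simp [mul_comm]

/-- Index `p` stands for the `(p + 1)`-fold convolution; each further factor raises the exponent by
`1 / 2` through a Beta integral, with `Γ(1/2) = √π`. -/
lemma kernelPow_zero_eq (p : ℕ) {s : ℝ} (hs : 0 < s) :
    kernelPow 0 p s = ENNReal.ofReal
      ((√2)⁻¹ ^ (p + 1) / Real.Gamma ((p + 1) / 2) * s ^ (((p : ℝ) + 1) / 2 - 1)) := by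
  induction p generalizing s with
  | zero =>
    rw [kernelPow, gaussianPDF_zero_apply_zero hs, Real.sqrt_mul zero_le_two]
    simp only [Nat.cast_zero, zero_add, pow_one, Real.Gamma_one_half_eq, mul_inv]
    rw [← div_eq_mul_inv]
  | succ p ih =>
    have hα : 0 < ((p : ℝ) + 1) / 2 := by positivity
    have hΓ := Real.Gamma_pos_of_pos hα
    have hC : 0 ≤ (√(2 * Real.pi))⁻¹ * ((√2)⁻¹ ^ (p + 1) / Real.Gamma ((p + 1) / 2)) := by
      positivity
    have key : ∀ r ∈ Set.Ioo 0 s, gaussianPDF 0 (s - r).toNNReal 0 * kernelPow 0 p r =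
        ENNReal.ofReal ((√(2 * Real.pi))⁻¹ * ((√2)⁻¹ ^ (p + 1) / Real.Gamma ((p + 1) / 2))) *
        ENNReal.ofReal ((s - r) ^ ((1 : ℝ) / 2 - 1) * r ^ (((p : ℝ) + 1) / 2 - 1)) := by
      intro r hr
      have h1 : 0 < s - r := sub_pos.2 hr.2
      rw [gaussianPDF_zero_apply_zero h1, ih hr.1, ← ENNReal.ofReal_mul (by positivity),
        ← ENNReal.ofReal_mul hC]
      congr 1
      ring
    rw [kernelPow, ← restrict_Ioo_eq_restrict_Ioc, setLIntegral_congr_fun measurableSet_Ioo key,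
      lintegral_const_mul' _ _ ENNReal.ofReal_ne_top, restrict_Ioo_eq_restrict_Ioc,
      lintegral_Ioc_rpow_mul_rpow hα one_half_pos hs, ← ENNReal.ofReal_mul hC, beta,
      Real.Gamma_one_half_eq, Real.sqrt_mul zero_le_two]
    congr 1
    rw [show ((p : ℝ) + 1) / 2 + 1 / 2 = ((p + 1 : ℕ) + 1) / 2 by push_cast; ring]
    have h2 : Real.Gamma (((p + 1 : ℕ) + 1) / 2) ≠ 0 := (Real.Gamma_pos_of_pos (by positivity)).ne'
    have := Real.sqrt_ne_zero'.2 Real.pi_pos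
    have h3 := Real.sqrt_ne_zero'.2 (zero_lt_two (α := ℝ))
    simp only [inv_pow]
    field_simp
    ring

lemma lintegral_Ioc_kernelPow_zero (p : ℕ) :
    (p + 1).factorial * ∫⁻ s in Set.Ioc 0 1, kernelPow 0 p s =
      ENNReal.ofReal (limitMoment (p + 1)) := by
  have hα : 0 < ((p : ℝ) + 1) / 2 := by positivity
  have hΓ := Real.Gamma_pos_of_pos hα
  have hC : 0 ≤ (√2)⁻¹ ^ (p + 1) / Real.Gamma ((p + 1) / 2) := by positivity
  -- The trivial factor `(1 - s) ^ 0` puts the integrand in Beta form with second parameter `1`.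
  have key : ∀ s ∈ Set.Ioc (0 : ℝ) 1, kernelPow 0 p s =
      ENNReal.ofReal ((√2)⁻¹ ^ (p + 1) / Real.Gamma ((p + 1) / 2)) *
        ENNReal.ofReal ((1 - s) ^ ((1 : ℝ) - 1) * s ^ (((p : ℝ) + 1) / 2 - 1)) := by
    intro s hs
    rw [kernelPow_zero_eq p hs.1, ← ENNReal.ofReal_mul hC]
    simp
  rw [setLIntegral_congr_fun measurableSet_Ioc key, lintegral_const_mul' _ _ ENNReal.ofReal_ne_top,
    lintegral_Ioc_rpow_mul_rpow hα one_pos one_pos, ← ENNReal.ofReal_mul hC,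
    ← ENNReal.ofReal_natCast, ← ENNReal.ofReal_mul (by positivity)]
  congr 1
  have hpow : (2 : ℝ) ^ (((p + 1 : ℕ) : ℝ) / 2) = √2 ^ (p + 1) := by
    rw [Real.sqrt_eq_rpow, ← Real.rpow_natCast, ← Real.rpow_mul zero_le_two]
    congr 1
    ring
  rw [limitMoment, hpow, beta, Real.Gamma_one]
  have := Real.Gamma_pos_of_pos (add_pos hα one_pos)
  push_cast
  simp only [Real.one_rpow, inv_pow]
  field_simp

lemma measurable_kernelPow (ε : ℝ) (p : ℕ) : Measurable (kernelPow ε p) := by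
  induction p with
  | zero => exact measurable_uncurry_gaussianPDF.comp (by fun_prop :
      Measurable fun s : ℝ ↦ ((0 : ℝ), s.toNNReal, ε))
  | succ p ih =>
    have h : Measurable fun q : ℝ × ℝ ↦ {q : ℝ × ℝ | q.2 ∈ Set.Ioc 0 q.1}.indicator
        (fun q ↦ gaussianPDF 0 (q.1 - q.2).toNNReal ε * kernelPow ε p q.2) q := by
      refine Measurable.indicator (Measurable.mul ?_ (ih.comp measurable_snd)) ?_
      · exact measurable_uncurry_gaussianPDF.comp (by fun_prop :
          Measurable fun q : ℝ × ℝ ↦ ((0 : ℝ), (q.1 - q.2).toNNReal, ε))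
      · exact (measurableSet_lt measurable_const measurable_snd).inter
          (measurableSet_le measurable_snd measurable_fst)
    convert Measurable.lintegral_prod_right' (ν := volume) h using 2 with s
    rw [kernelPow, ← lintegral_indicator measurableSet_Ioc]
    rfl

lemma measurable_gaussianPDF_sub_mul_kernelPow (ε s : ℝ) (p : ℕ) :
    Measurable fun r ↦ gaussianPDF 0 (s - r).toNNReal ε * kernelPow ε p r :=
  (measurable_uncurry_gaussianPDF.comp (by fun_prop :
    Measurable fun r : ℝ ↦ ((0 : ℝ), (s - r).toNNReal, ε))).mul (measurable_kernelPow ε p)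

lemma kernelPow_le_kernelPow_zero (ε : ℝ) (p : ℕ) (s : ℝ) : kernelPow ε p s ≤ kernelPow 0 p s := by
  induction p generalizing s with
  | zero => exact gaussianPDF_zero_le_of_abs_le (by simp)
  | succ p ih =>
    exact lintegral_mono fun r ↦ mul_le_mul' (gaussianPDF_zero_le_of_abs_le (by simp)) (ih r)

lemma tendsto_gaussianPDF_zero (v : ℝ≥0) :
    Tendsto (fun ε ↦ gaussianPDF 0 v ε) (𝓝[>] 0) (𝓝 (gaussianPDF 0 v 0)) := by
  refine tendsto_nhdsWithin_of_tendsto_nhds (Continuous.tendsto ?_ 0)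
  refine ENNReal.continuous_ofReal.comp ?_
  rw [gaussianPDFReal_def]
  fun_prop

/-- The density is largest at `0`, so the integrand at `ε = 0` is a majorant; its integral is the
next kernel power, which is finite by the explicit formula. -/
lemma tendsto_kernelPow (p : ℕ) {s : ℝ} (hs : 0 < s) :
    Tendsto (fun ε ↦ kernelPow ε p s) (𝓝[>] 0) (𝓝 (kernelPow 0 p s)) := by
  induction p generalizing s with
  | zero => exact tendsto_gaussianPDF_zero _
  | succ p ih =>
    have hfin : kernelPow 0 (p + 1) s ≠ ∞ := by
      rw [kernelPow_zero_eq _ hs]; exact ENNReal.ofReal_ne_top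
    refine tendsto_lintegral_filter_of_dominated_convergence
      (fun r ↦ gaussianPDF 0 (s - r).toNNReal 0 * kernelPow 0 p r)
      (.of_forall fun ε ↦ measurable_gaussianPDF_sub_mul_kernelPow ε s p)
      (.of_forall fun ε ↦ .of_forall fun r ↦ mul_le_mul'
        (gaussianPDF_zero_le_of_abs_le (by simp)) (kernelPow_le_kernelPow_zero ε p r)) hfin ?_
    refine ae_restrict_of_forall_mem measurableSet_Ioc fun r hr ↦ ?_
    refine ENNReal.Tendsto.mul (tendsto_gaussianPDF_zero _) (.inr ?_) (ih hr.1)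
      (.inr gaussianPDF_ne_top)
    rw [kernelPow_zero_eq _ hr.1]
    exact ENNReal.ofReal_ne_top

lemma tendsto_lintegral_Ioc_kernelPow (p : ℕ) :
    Tendsto (fun ε ↦ (p + 1).factorial * ∫⁻ s in Set.Ioc 0 1, kernelPow ε p s) (𝓝[>] 0)
      (𝓝 (ENNReal.ofReal (limitMoment (p + 1)))) := by
  have hf := lintegral_Ioc_kernelPow_zero p
  rw [← hf]
  refine ENNReal.Tendsto.const_mul ?_ (.inr (ENNReal.natCast_ne_top _))
  refine tendsto_lintegral_filter_of_dominated_convergence (kernelPow 0 p)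
    (.of_forall fun ε ↦ measurable_kernelPow ε p)
    (.of_forall fun ε ↦ .of_forall fun r ↦ kernelPow_le_kernelPow_zero ε p r) ?_
    (ae_restrict_of_forall_mem measurableSet_Ioc fun r hr ↦ tendsto_kernelPow p hr.1)
  intro htop
  rw [htop, ENNReal.mul_top (by simp [Nat.factorial_ne_zero])] at hf
  exact ENNReal.ofReal_ne_top hf.symm

/-! ### Two-sided bounds for the moments of the occupation time -/

section OccupationMoments

variable {Ω : Type*} {mΩ : MeasurableSpace Ω} {P : Measure Ω} {W : ℝ≥0 → Ω → ℝ}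

/-- The set is written with `0 + z` to match the strip estimates at starting point `0`. -/
lemma lintegral_inStrip (hW : IsPreBrownianReal W P) (hm : ∀ t, Measurable (W t)) (ε s : ℝ) :
    ∫⁻ ω, inStrip (W · ω) ε s ∂P = gaussianReal 0 s.toNNReal {z | |0 + z| ≤ ε / 2} := by
  simp only [zero_add]
  rw [← (hW.hasLaw_eval s.toNNReal).map_eq, ← lintegral_indicator_one (measurableSet_strip ε),
    lintegral_map (measurable_one.indicator (measurableSet_strip ε)) (hm _)]
  rfl

variable [IsProbabilityMeasure P]

lemma lintegral_occupationTime_pow_succ (hc : ∀ ω, Continuous (W · ω))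
    (hm : ∀ t, Measurable (W t)) (ε t : ℝ) (p : ℕ) :
    ∫⁻ ω, occupationTime (W · ω) ε t ^ (p + 1) ∂P = (p + 1) * ∫⁻ r in Set.Ioc 0 t,
      ∫⁻ ω, inStrip (W · ω) ε r * occupationTime (W · ω) ε r ^ p ∂P := by
  have hjoint : Measurable fun q : Ω × ℝ ↦
      inStrip (W · q.1) ε q.2 * occupationTime (W · q.1) ε q.2 ^ p :=
    ((measurable_inStrip_uncurry hc hm ε).mul
      ((measurable_occupationTime_uncurry hc hm ε).pow_const p)).comp measurable_swap
  rw [← lintegral_lintegral_swap hjoint.aemeasurable, ← lintegral_const_mul' _ _ (by finiteness)]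
  exact lintegral_congr fun ω ↦ setLIntegral_Ioc_pow_succ (measurable_inStrip_path hc ε ω) p t

lemma lintegral_inStrip_mul_occupationTime_pow_succ (hc : ∀ ω, Continuous (W · ω))
    (hm : ∀ t, Measurable (W t)) (ε s : ℝ) (p : ℕ) :
    ∫⁻ ω, inStrip (W · ω) ε s * occupationTime (W · ω) ε s ^ (p + 1) ∂P =
      (p + 1) * ∫⁻ r in Set.Ioc 0 s, ∫⁻ ω, inStrip (W · ω) ε s *
        (inStrip (W · ω) ε r * occupationTime (W · ω) ε r ^ p) ∂P := by
  have hjoint : Measurable fun q : Ω × ℝ ↦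
      inStrip (W · q.1) ε q.2 * occupationTime (W · q.1) ε q.2 ^ p :=
    ((measurable_inStrip_uncurry hc hm ε).mul
      ((measurable_occupationTime_uncurry hc hm ε).pow_const p)).comp measurable_swap
  have hjoint' : Measurable fun q : Ω × ℝ ↦ inStrip (W · q.1) ε s *
      (inStrip (W · q.1) ε q.2 * occupationTime (W · q.1) ε q.2 ^ p) :=
    ((measurable_inStrip hm ε s).comp measurable_fst).mul hjoint
  rw [← lintegral_lintegral_swap hjoint'.aemeasurable, ← lintegral_const_mul' _ _ (by finiteness)]
  refine lintegral_congr fun ω ↦ ?_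
  have hω : Measurable fun r ↦ inStrip (W · ω) ε r * occupationTime (W · ω) ε r ^ p :=
    hjoint.comp measurable_prodMk_left
  rw [lintegral_const_mul _ hω, ← mul_left_comm]
  congr 1
  exact setLIntegral_Ioc_pow_succ (measurable_inStrip_path hc ε ω) p s

/-- Going back from `s` to the preceding time `r`, the Markov bound contributes `ε` and one
convolution factor, and the choice of the latest time contributes the factor `p + 1`. -/
lemma lintegral_inStrip_mul_occupationTime_pow_le (hW : IsPreBrownianReal W P)
    (hc : ∀ ω, Continuous (W · ω)) (hm : ∀ t, Measurable (W t)) (ε : ℝ) (p : ℕ) {s : ℝ}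
    (hs : 0 < s) :
    ∫⁻ ω, inStrip (W · ω) ε s * occupationTime (W · ω) ε s ^ p ∂P ≤
      ENNReal.ofReal ε ^ (p + 1) * p.factorial * kernelPow 0 p s := by
  induction p generalizing s with
  | zero =>
    simpa [lintegral_inStrip hW hm, kernelPow] using
      gaussianReal_strip_le (v := s.toNNReal) (by simpa using hs) 0 ε
  | succ p ih =>
    have hstep : ∀ r ∈ Set.Ioo 0 s, ∫⁻ ω, inStrip (W · ω) ε s *
        (inStrip (W · ω) ε r * occupationTime (W · ω) ε r ^ p) ∂P ≤
        ENNReal.ofReal ε ^ (p + 2) * p.factorial *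
          (gaussianPDF 0 (s - r).toNNReal 0 * kernelPow 0 p r) := by
      intro r hr
      have hX : Measurable[MeasurableSpace.comap (fun ω (t : Set.Iic r.toNNReal) ↦ W t ω)
          inferInstance] fun ω ↦ occupationTime (W · ω) ε r ^ p := by
        have := measurable_occupationTime_comap hc ε r.toNNReal
        rw [Real.coe_toNNReal _ hr.1.le] at this
        exact this.pow_const p
      calc _ ≤ ENNReal.ofReal ε * gaussianPDF 0 (s - r).toNNReal 0 *
            (ENNReal.ofReal ε ^ (p + 1) * p.factorial * kernelPow 0 p r) :=
          (lintegral_inStrip_mul_inStrip_mul_le hW hm hr.1.le hr.2 ε hX).trans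
            (mul_le_mul_right (ih hr.1) _)
        _ = _ := by ring
    -- The endpoint `r = s`, where the increment is degenerate, is discarded as a null set.
    rw [lintegral_inStrip_mul_occupationTime_pow_succ hc hm, ← restrict_Ioo_eq_restrict_Ioc,
      kernelPow]
    calc _ ≤ (p + 1 : ℝ≥0∞) * ∫⁻ r in Set.Ioo 0 s, ENNReal.ofReal ε ^ (p + 2) * p.factorial *
          (gaussianPDF 0 (s - r).toNNReal 0 * kernelPow 0 p r) :=
        mul_le_mul_right (setLIntegral_mono' measurableSet_Ioo hstep) _
      _ = _ := by
        rw [lintegral_const_mul' _ _ (by finiteness), restrict_Ioo_eq_restrict_Ioc,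
          Nat.factorial_succ]
        push_cast
        ring

lemma le_lintegral_inStrip_mul_occupationTime_pow (hW : IsPreBrownianReal W P)
    (hc : ∀ ω, Continuous (W · ω)) (hm : ∀ t, Measurable (W t)) {ε : ℝ} (hε : 0 < ε) (p : ℕ)
    {s : ℝ} (hs : 0 < s) :
    ENNReal.ofReal ε ^ (p + 1) * p.factorial * kernelPow ε p s ≤
      ∫⁻ ω, inStrip (W · ω) ε s * occupationTime (W · ω) ε s ^ p ∂P := by
  induction p generalizing s with
  | zero =>
    simpa [lintegral_inStrip hW hm, kernelPow] using
      le_gaussianReal_strip (v := s.toNNReal) (by simpa using hs) (y := 0) (ε := ε)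
        (by simpa using (half_pos hε).le)
  | succ p ih =>
    have hstep : ∀ r ∈ Set.Ioo 0 s, ENNReal.ofReal ε ^ (p + 2) * p.factorial *
          (gaussianPDF 0 (s - r).toNNReal ε * kernelPow ε p r) ≤
        ∫⁻ ω, inStrip (W · ω) ε s *
        (inStrip (W · ω) ε r * occupationTime (W · ω) ε r ^ p) ∂P := by
      intro r hr
      have hX : Measurable[MeasurableSpace.comap (fun ω (t : Set.Iic r.toNNReal) ↦ W t ω)
          inferInstance] fun ω ↦ occupationTime (W · ω) ε r ^ p := by
        have := measurable_occupationTime_comap hc ε r.toNNReal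
        rw [Real.coe_toNNReal _ hr.1.le] at this
        exact this.pow_const p
      calc _ = ENNReal.ofReal ε * gaussianPDF 0 (s - r).toNNReal ε *
            (ENNReal.ofReal ε ^ (p + 1) * p.factorial * kernelPow ε p r) := by ring
        _ ≤ _ := (mul_le_mul_right (ih hr.1) _).trans
            (le_lintegral_inStrip_mul_inStrip_mul hW hm hr.1.le hr.2 ε hX)
    rw [lintegral_inStrip_mul_occupationTime_pow_succ hc hm, ← restrict_Ioo_eq_restrict_Ioc,
      kernelPow]
    calc _ = (p + 1 : ℝ≥0∞) * ∫⁻ r in Set.Ioo 0 s, ENNReal.ofReal ε ^ (p + 2) * p.factorial *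
          (gaussianPDF 0 (s - r).toNNReal ε * kernelPow ε p r) := by
          rw [lintegral_const_mul' _ _ (by finiteness), restrict_Ioo_eq_restrict_Ioc,
            Nat.factorial_succ]
          push_cast
          ring
      _ ≤ _ := mul_le_mul_right (setLIntegral_mono' measurableSet_Ioo hstep) _

lemma lintegral_occupationTime_pow_le (hW : IsPreBrownianReal W P)
    (hc : ∀ ω, Continuous (W · ω)) (hm : ∀ t, Measurable (W t)) (ε t : ℝ) (p : ℕ) :
    ∫⁻ ω, occupationTime (W · ω) ε t ^ (p + 1) ∂P ≤ ENNReal.ofReal ε ^ (p + 1) *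
      ((p + 1).factorial * ∫⁻ s in Set.Ioc 0 t, kernelPow 0 p s) := by
  rw [lintegral_occupationTime_pow_succ hc hm]
  calc _ ≤ (p + 1 : ℝ≥0∞) * ∫⁻ s in Set.Ioc 0 t,
        ENNReal.ofReal ε ^ (p + 1) * p.factorial * kernelPow 0 p s :=
      mul_le_mul_right (setLIntegral_mono' measurableSet_Ioc fun s hs ↦
        lintegral_inStrip_mul_occupationTime_pow_le hW hc hm ε p hs.1) _
    _ = _ := by
      rw [lintegral_const_mul' _ _ (by finiteness), Nat.factorial_succ]
      push_cast
      ring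

lemma le_lintegral_occupationTime_pow (hW : IsPreBrownianReal W P)
    (hc : ∀ ω, Continuous (W · ω)) (hm : ∀ t, Measurable (W t)) {ε : ℝ} (hε : 0 < ε) (t : ℝ)
    (p : ℕ) :
    ENNReal.ofReal ε ^ (p + 1) *
      ((p + 1).factorial * ∫⁻ s in Set.Ioc 0 t, kernelPow ε p s) ≤
      ∫⁻ ω, occupationTime (W · ω) ε t ^ (p + 1) ∂P := by
  rw [lintegral_occupationTime_pow_succ hc hm]
  calc _ = (p + 1 : ℝ≥0∞) * ∫⁻ s in Set.Ioc 0 t,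
        ENNReal.ofReal ε ^ (p + 1) * p.factorial * kernelPow ε p s := by
        rw [lintegral_const_mul' _ _ (by finiteness), Nat.factorial_succ]
        push_cast
        ring
    _ ≤ _ := mul_le_mul_right (setLIntegral_mono' measurableSet_Ioc fun s hs ↦
        le_lintegral_inStrip_mul_occupationTime_pow hW hc hm hε p hs.1) _

end OccupationMoments

/-! ### Absolute moments of the standard normal law -/

lemma integrable_abs_pow_gaussianReal (p : ℕ) :
    Integrable (fun x : ℝ ↦ |x| ^ p) (gaussianReal 0 1) := by
  simpa using (memLp_id_gaussianReal (μ := 0) (v := 1) p).integrable_norm_pow'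

lemma integral_abs_pow_gaussianReal (p : ℕ) :
    ∫ x : ℝ, |x| ^ p ∂(gaussianReal 0 1) = limitMoment p := by
  have h1 : ∫ x : ℝ, |x| ^ p ∂(gaussianReal 0 1) =
      2 * ∫ x in Set.Ioi (0 : ℝ), (√(2 * Real.pi))⁻¹ * (x ^ (p : ℝ) * Real.exp (-(1 / 2) * x ^ (2 : ℝ))) := by
    rw [integral_gaussianReal_eq_integral_smul one_ne_zero, ← integral_comp_abs]
    refine integral_congr_ae (.of_forall fun x ↦ ?_)
    simp only [gaussianPDFReal, smul_eq_mul, sub_zero, NNReal.coe_one, mul_one, Real.rpow_natCast,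
      Real.rpow_ofNat, sq_abs]
    ring_nf
  -- The Gaussian integral produces `Γ((p + 1) / 2)`; Legendre duplication exchanges it for `p! /
  -- Γ(p / 2 + 1)`.
  have h2 := Real.Gamma_mul_Gamma_add_half (((p : ℝ) + 1) / 2)
  rw [show ((p : ℝ) + 1) / 2 + 1 / 2 = (p : ℝ) / 2 + 1 by ring,
    show 2 * (((p : ℝ) + 1) / 2) = p + 1 by ring, Real.Gamma_nat_eq_factorial,
    show (1 : ℝ) - (p + 1) = -p by ring, Real.rpow_neg zero_le_two, Real.rpow_natCast] at h2
  have hG : 0 < Real.Gamma ((p : ℝ) / 2 + 1) := Real.Gamma_pos_of_pos (by positivity)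
  have hp : (2 : ℝ) ^ ((p : ℝ) / 2) = √2 ^ p := by
    rw [Real.sqrt_eq_rpow, ← Real.rpow_natCast, ← Real.rpow_mul zero_le_two]
    congr 1
    ring
  have hq : (1 / 2 : ℝ) ^ (-((p : ℝ) + 1) / 2) = √2 ^ (p + 1) := by
    rw [one_div, Real.inv_rpow zero_le_two, ← Real.rpow_neg zero_le_two, Real.sqrt_eq_rpow,
      ← Real.rpow_natCast, ← Real.rpow_mul zero_le_two]
    congr 1
    push_cast
    ring
  have hpi : 0 < √Real.pi := Real.sqrt_pos.2 Real.pi_pos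
  rw [h1, integral_const_mul, integral_rpow_mul_exp_neg_mul_rpow two_pos
    (by linarith [p.cast_nonneg (α := ℝ)]) one_half_pos, limitMoment, hp, hq,
    Real.sqrt_mul zero_le_two, eq_div_iff (by positivity)]
  have h4 : √2 ^ p * √2 ^ p = (2 : ℝ) ^ p := by
    rw [← mul_pow, Real.mul_self_sqrt zero_le_two]
  field_simp at h2 ⊢
  rw [pow_succ]
  linear_combination √2 * h2 + √2 * Real.Gamma ((p + 1) / 2) * Real.Gamma ((p + 2) / 2) * h4

lemma integrable_exp_mul_abs_gaussianReal (t : ℝ) :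
    Integrable (fun x : ℝ ↦ Real.exp (t * |x|)) (gaussianReal 0 1) :=
  integrable_exp_mul_abs (X := id) (integrable_exp_mul_gaussianReal t)
    (integrable_exp_mul_gaussianReal (-t))

/-! ### Method of moments -/

section MethodOfMoments

variable {Ω Ω' ι : Type*} {mΩ : MeasurableSpace Ω} {mΩ' : MeasurableSpace Ω'}
  {P : Measure Ω} {P' : Measure Ω'}

/-- The partial sums are integrals of partial sums of `exp (|t| |Z|)`, hence bounded by its
integral. -/
lemma summable_pow_div_factorial_mul_integral {Z : Ω' → ℝ} (t : ℝ)
    (hZm : ∀ p : ℕ, Integrable (fun ω ↦ |Z ω| ^ p) P')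
    (hZ : Integrable (fun ω ↦ Real.exp (|t| * |Z ω|)) P') :
    Summable fun p : ℕ ↦ |t| ^ p / p.factorial * ∫ ω, |Z ω| ^ p ∂P' := by
  refine summable_of_sum_range_le (c := ∫ ω, Real.exp (|t| * |Z ω|) ∂P')
    (fun p ↦ mul_nonneg (by positivity) (integral_nonneg fun ω ↦ by positivity)) fun n ↦ ?_
  simp_rw [← integral_const_mul]
  rw [← integral_finsetSum _ fun p _ ↦ (hZm p).const_mul _]
  refine integral_mono (integrable_finsetSum _ fun p _ ↦ (hZm p).const_mul _) hZ fun ω ↦ ?_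
  refine le_trans (Finset.sum_le_sum fun p _ ↦ le_of_eq ?_)
    (Real.sum_le_exp_of_nonneg (x := |t| * |Z ω|) (by positivity) n)
  rw [mul_pow]
  ring

lemma charFun_map_eq_tsum {X : Ω → ℝ} (hX : AEMeasurable X P) (t : ℝ)
    (hXm : ∀ p : ℕ, Integrable (fun ω ↦ X ω ^ p) P)
    (hs : Summable fun p : ℕ ↦ |t| ^ p / p.factorial * ∫ ω, |X ω| ^ p ∂P) :
    charFun (P.map X) t =
      ∑' p : ℕ, (t * Complex.I) ^ p / p.factorial * ((∫ ω, X ω ^ p ∂P : ℝ) : ℂ) := by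
  have hterm : ∀ p : ℕ, (t * Complex.I) ^ p / p.factorial * ((∫ ω, X ω ^ p ∂P : ℝ) : ℂ) =
      ∫ ω, (t * Complex.I) ^ p / p.factorial * ((X ω ^ p : ℝ) : ℂ) ∂P := fun p ↦ by
    rw [integral_const_mul, integral_complex_ofReal]
  have hnorm : ∀ p : ℕ, ∫ ω, ‖(t * Complex.I) ^ p / p.factorial * ((X ω ^ p : ℝ) : ℂ)‖ ∂P =
      |t| ^ p / p.factorial * ∫ ω, |X ω| ^ p ∂P := fun p ↦ by
    rw [← integral_const_mul]
    simp
  simp_rw [hterm]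
  rw [integral_tsum_of_summable_integral_norm, charFun_apply_real, integral_map hX (by fun_prop)]
  · refine integral_congr_ae (.of_forall fun ω ↦ ?_)
    simp only [Complex.exp_eq_exp_ℂ, NormedSpace.exp_eq_tsum_div]
    refine tsum_congr fun p ↦ ?_
    push_cast
    ring
  · exact fun p ↦ (hXm p).ofReal.const_mul _
  · simpa only [hnorm] using hs

/-- **Method of moments**, for limits with exponential moments and moments
bounded by those of the limit. -/
lemma tendstoInDistribution_of_tendsto_integral_pow [IsProbabilityMeasure P]
    [IsProbabilityMeasure P'] {l : Filter ι} [l.IsCountablyGenerated]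
    {X : ι → Ω → ℝ} {Z : Ω' → ℝ} (hX : ∀ i, AEMeasurable (X i) P) (hZ : AEMeasurable Z P')
    (hXm : ∀ᶠ i in l, ∀ p : ℕ, Integrable (fun ω ↦ X i ω ^ p) P)
    (hle : ∀ᶠ i in l, ∀ p : ℕ, ∫ ω, |X i ω| ^ p ∂P ≤ ∫ ω, |Z ω| ^ p ∂P')
    (hZm : ∀ p : ℕ, Integrable (fun ω ↦ Z ω ^ p) P')
    (hZe : ∀ t : ℝ, Integrable (fun ω ↦ Real.exp (t * |Z ω|)) P')
    (hlim : ∀ p : ℕ, Tendsto (fun i ↦ ∫ ω, X i ω ^ p ∂P) l (𝓝 (∫ ω, Z ω ^ p ∂P'))) :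
    TendstoInDistribution X l Z (fun _ ↦ P) P' where
  forall_aemeasurable := hX
  aemeasurable_limit := hZ
  tendsto := by
    have hZs (t : ℝ) := summable_pow_div_factorial_mul_integral t
      (fun p ↦ by simpa using (hZm p).norm) (hZe |t|)
    have hchar : ∀ t : ℝ, Tendsto (fun i ↦ charFun (P.map (X i)) t) l
        (𝓝 (charFun (P'.map Z) t)) := by
      intro t
      have hev : ∀ᶠ i in l, ∑' p : ℕ, (t * Complex.I) ^ p / p.factorial *
          ((∫ ω, X i ω ^ p ∂P : ℝ) : ℂ) = charFun (P.map (X i)) t := by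
        filter_upwards [hXm, hle] with i hi hi'
        refine (charFun_map_eq_tsum (hX i) t hi (Summable.of_nonneg_of_le (fun p ↦ ?_)
          (fun p ↦ ?_) (hZs t))).symm
        · exact mul_nonneg (by positivity) (integral_nonneg fun ω ↦ by positivity)
        · exact mul_le_mul_of_nonneg_left (hi' p) (by positivity)
      rw [charFun_map_eq_tsum hZ t hZm (hZs t)]
      -- The moment series of `Z` dominates those of all `X i` eventually along `l`, so the limit
      -- passes termwise.
      refine Tendsto.congr' hev (tendsto_tsum_of_dominated_convergence (hZs t) (fun p ↦ ?_) ?_)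
      · exact ((Complex.continuous_ofReal.tendsto _).comp (hlim p)).const_mul _
      · filter_upwards [hle] with i hi p
        simp only [norm_mul, norm_div, norm_pow, Complex.norm_real, Complex.norm_I, mul_one,
          Real.norm_eq_abs, Complex.norm_natCast]
        refine mul_le_mul_of_nonneg_left (le_trans ?_ (hi p)) (by positivity)
        refine abs_integral_le_integral_abs.trans (le_of_eq ?_)
        simp only [abs_pow]
    -- Lévy's theorem is applied along sequences, which suffices for a countably generated filter.
    refine tendsto_of_seq_tendsto fun u hu ↦ ?_
    exact ProbabilityMeasure.tendsto_of_tendsto_charFun fun t ↦ (hchar t).comp hu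

end MethodOfMoments

/-! ### Regular version, scaling, and limits of the relative time -/

section RelativeTime

variable {Ω : Type*} {mΩ : MeasurableSpace Ω} {P : Measure Ω} {W : ℝ≥0 → Ω → ℝ}

/-- A Brownian motion is indistinguishable from one with measurable marginals and
everywhere continuous paths. -/
lemma ProbabilityTheory.IsBrownianReal.exists_continuous_measurable (hW : IsBrownianReal W P) :
    ∃ B : ℝ≥0 → Ω → ℝ, IsPreBrownianReal B P ∧ (∀ ω, Continuous (B · ω)) ∧
      (∀ t, Measurable (B t)) ∧ ∀ᵐ ω ∂P, ∀ t, W t ω = B t ω := by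
  -- Marginals are only almost everywhere measurable. Measurable versions at countably many dense
  -- times agree with `W` off one null set; continuity there recovers measurability at every time.
  let D : ℕ → ℝ≥0 := TopologicalSpace.denseSeq ℝ≥0
  have hgood : ∀ᵐ ω ∂P, Continuous (W · ω) ∧
      ∀ n, W (D n) ω = (hW.aemeasurable (D n)).mk (W (D n)) ω :=
    hW.cont.and (ae_all_iff.2 fun n ↦ (hW.aemeasurable (D n)).ae_eq_mk)
  obtain ⟨N, hN, hNm, hN0⟩ := exists_measurable_superset_of_null (ae_iff.1 hgood)
  have hsub : ∀ ω ∈ Nᶜ, Continuous (W · ω) ∧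
      ∀ n, W (D n) ω = (hW.aemeasurable (D n)).mk (W (D n)) ω := by
    intro ω hω
    by_contra h
    exact hω (hN h)
  have hae : ∀ᵐ ω ∂P, ∀ t, W t ω = Nᶜ.indicator (W t) ω := by
    filter_upwards [compl_mem_ae_iff.2 hN0] with ω hω t
    exact (Set.indicator_of_mem hω _).symm
  refine ⟨fun t ↦ Nᶜ.indicator (W t), hW.toIsPreBrownianReal.congr fun t ↦ ?_, fun ω ↦ ?_,
    fun t ↦ ?_, hae⟩
  · filter_upwards [hae] with ω hω using hω t
  · by_cases hω : ω ∈ Nᶜ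
    · simpa only [Set.indicator_of_mem hω] using (hsub ω hω).1
    · simpa only [Set.indicator_of_notMem hω] using continuous_const
  · obtain ⟨u, hu, hlim⟩ := mem_closure_iff_seq_limit.1
      (TopologicalSpace.denseRange_denseSeq ℝ≥0 t)
    choose k hk using hu
    refine measurable_of_tendsto_metrizable
      (f := fun n ↦ Nᶜ.indicator ((hW.aemeasurable (D (k n))).mk (W (D (k n)))))
      (fun n ↦ (hW.aemeasurable _).measurable_mk.indicator hNm.compl)
      (tendsto_pi_nhds.2 fun ω ↦ ?_)
    by_cases hω : ω ∈ Nᶜ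
    · simp only [Set.indicator_of_mem hω, ← (hsub ω hω).2]
      have : (fun n ↦ W (D (k n)) ω) = fun n ↦ W (u n) ω := funext fun n ↦ by rw [← hk n]
      rw [this]
      exact ((hsub ω hω).1.tendsto t).comp hlim
    · simp only [Set.indicator_of_notMem hω]
      exact tendsto_const_nhds

lemma relativeTime_eq_occupationTime {w : ℝ≥0 → ℝ} (hw : Continuous w) (ε T : ℝ) :
    relativeTime w ε T = (ε * √T)⁻¹ * (occupationTime w ε T).toReal := by
  have hS : MeasurableSet {t : ℝ | |w t.toNNReal| ≤ ε / 2} :=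
    (hw.comp continuous_real_toNNReal).measurable (measurableSet_strip ε)
  have h : occupationTime w ε T =
      volume {t : ℝ | t ∈ Set.Icc 0 T ∧ |w t.toNNReal| ≤ ε / 2} := by
    have h1 : occupationTime w ε T =
        ∫⁻ s in Set.Ioc 0 T, {t : ℝ | |w t.toNNReal| ≤ ε / 2}.indicator 1 s := rfl
    rw [h1, lintegral_indicator_one hS, restrict_Ioc_eq_restrict_Icc, Measure.restrict_apply hS,
      Set.inter_comm]
    rfl
  rw [relativeTime, h, measureReal_def]

lemma occupationTime_le (w : ℝ≥0 → ℝ) (ε T : ℝ) : occupationTime w ε T ≤ ENNReal.ofReal T := by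
  calc _ ≤ ∫⁻ _ in Set.Ioc 0 T, (1 : ℝ≥0∞) :=
        lintegral_mono fun s ↦ Set.indicator_le_self' (f := (1 : ℝ → ℝ≥0∞)) (by simp) _
    _ = _ := by simp

lemma relativeTime_nonneg (w : ℝ≥0 → ℝ) {ε : ℝ} (hε : 0 ≤ ε) (T : ℝ) :
    0 ≤ relativeTime w ε T := by
  unfold relativeTime
  positivity

lemma relativeTime_le (w : ℝ≥0 → ℝ) {ε T : ℝ} (hε : 0 ≤ ε) (hT : 0 ≤ T) :
    relativeTime w ε T ≤ (ε * √T)⁻¹ * T := by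
  refine mul_le_mul_of_nonneg_left ?_ (by positivity)
  calc _ ≤ volume.real (Set.Icc 0 T) := measureReal_mono (fun t ht ↦ ht.1) (by simp)
    _ = T := by simp [hT]

lemma aemeasurable_relativeTime (hW : IsBrownianReal W P) (ε T : ℝ) :
    AEMeasurable (fun ω ↦ relativeTime (W · ω) ε T) P := by
  obtain ⟨B, -, hc, hm, hae⟩ := hW.exists_continuous_measurable
  refine ⟨fun ω ↦ (ε * √T)⁻¹ * (occupationTime (B · ω) ε T).toReal,
    (measurable_occupationTime hc hm ε T).ennreal_toReal.const_mul _, ?_⟩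
  filter_upwards [hae] with ω hω
  rw [← relativeTime_eq_occupationTime (hc ω)]
  simp only [hω]

/-- Brownian scaling of the relative time. -/
lemma relativeTime_eq_relativeTime_one (w : ℝ≥0 → ℝ) (ε : ℝ) {T : ℝ} (hT : 0 < T) :
    relativeTime w ε T =
      relativeTime (fun t ↦ (√(T.toNNReal : ℝ))⁻¹ * w (T.toNNReal * t)) (ε / √T) 1 := by
  have hsq : 0 < √T := Real.sqrt_pos.2 hT
  have hset : {t : ℝ | t ∈ Set.Icc 0 1 ∧
      |(√(T.toNNReal : ℝ))⁻¹ * w (T.toNNReal * t.toNNReal)| ≤ ε / √T / 2} =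
      (T * ·) ⁻¹' {t : ℝ | t ∈ Set.Icc 0 T ∧ |w t.toNNReal| ≤ ε / 2} := by
    ext t
    simp only [Set.mem_ofPred_eq, Set.mem_preimage, Set.mem_Icc, Real.coe_toNNReal _ hT.le,
      abs_mul, abs_inv, abs_of_pos hsq, Real.toNNReal_mul hT.le]
    refine and_congr (and_congr ?_ ?_) ?_
    · exact (mul_nonneg_iff_of_pos_left hT).symm
    · exact (mul_le_iff_le_one_right hT).symm
    · rw [inv_mul_le_iff₀ hsq, div_right_comm, mul_div_cancel₀ _ hsq.ne']
  rw [relativeTime, relativeTime, hset, measureReal_def, measureReal_def,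
    Real.volume_preimage_mul_left hT.ne', ENNReal.toReal_mul, abs_of_pos (inv_pos.2 hT),
    ENNReal.toReal_ofReal (inv_nonneg.2 hT.le), ← mul_assoc, Real.sqrt_one, mul_one]
  congr 1
  have hTT : (√T)⁻¹ = √T * T⁻¹ := by
    rw [← div_eq_mul_inv, Real.sqrt_div_self]
  rw [mul_inv, inv_div, hTT]
  ring

lemma integral_relativeTime_pow_eq (hW : IsBrownianReal W P) {ε : ℝ} (hε : 0 ≤ ε) (T : ℝ)
    (p : ℕ) : ∫ ω, relativeTime (W · ω) ε T ^ p ∂P =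
      (∫⁻ ω, ENNReal.ofReal (relativeTime (W · ω) ε T ^ p) ∂P).toReal :=
  integral_eq_lintegral_of_nonneg_ae
    (.of_forall fun _ ↦ pow_nonneg (relativeTime_nonneg _ hε T) p)
    ((aemeasurable_relativeTime hW ε T).pow_const p).aestronglyMeasurable

variable [IsProbabilityMeasure P]

lemma integrable_relativeTime_pow (hW : IsBrownianReal W P) (p : ℕ) {ε T : ℝ} (hε : 0 ≤ ε)
    (hT : 0 ≤ T) : Integrable (fun ω ↦ relativeTime (W · ω) ε T ^ p) P := by
  refine Integrable.of_bound ((aemeasurable_relativeTime hW ε T).pow_const p).aestronglyMeasurable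
    (((ε * √T)⁻¹ * T) ^ p) (.of_forall fun ω ↦ ?_)
  rw [norm_pow, Real.norm_of_nonneg (relativeTime_nonneg _ hε T)]
  exact pow_le_pow_left₀ (relativeTime_nonneg _ hε T) (relativeTime_le _ hε hT) p

lemma lintegral_relativeTime_one_pow_bounds (hW : IsBrownianReal W P) {ε : ℝ} (hε : 0 < ε)
    (p : ℕ) :
    (p + 1).factorial * ∫⁻ s in Set.Ioc 0 1, kernelPow ε p s ≤
        ∫⁻ ω, ENNReal.ofReal (relativeTime (W · ω) ε 1 ^ (p + 1)) ∂P ∧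
      ∫⁻ ω, ENNReal.ofReal (relativeTime (W · ω) ε 1 ^ (p + 1)) ∂P ≤
        ENNReal.ofReal (limitMoment (p + 1)) := by
  obtain ⟨B, hB, hc, hm, hae⟩ := hW.exists_continuous_measurable
  have hε' : ENNReal.ofReal ε ^ (p + 1) ≠ 0 := by simpa using hε
  have hcancel (x : ℝ≥0∞) :
      (ENNReal.ofReal ε ^ (p + 1))⁻¹ * (ENNReal.ofReal ε ^ (p + 1) * x) = x := by
    rw [← mul_assoc, ENNReal.inv_mul_cancel hε' (by finiteness), one_mul]
  have heq : ∫⁻ ω, ENNReal.ofReal (relativeTime (W · ω) ε 1 ^ (p + 1)) ∂P =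
      (ENNReal.ofReal ε ^ (p + 1))⁻¹ * ∫⁻ ω, occupationTime (B · ω) ε 1 ^ (p + 1) ∂P := by
    rw [← lintegral_const_mul' _ _ (ENNReal.inv_ne_top.2 hε')]
    refine lintegral_congr_ae ?_
    filter_upwards [hae] with ω hω
    have hfin : occupationTime (B · ω) ε 1 ≠ ∞ :=
      ne_top_of_le_ne_top ENNReal.ofReal_ne_top (occupationTime_le _ ε 1)
    simp only [hω]
    rw [relativeTime_eq_occupationTime (hc ω), Real.sqrt_one, mul_one,
      ENNReal.ofReal_pow (by positivity), ENNReal.ofReal_mul (by positivity),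
      ENNReal.ofReal_toReal hfin, mul_pow, ENNReal.ofReal_inv_of_pos hε, ENNReal.inv_pow]
  rw [heq]
  constructor
  · rw [← hcancel ((p + 1).factorial * _)]
    exact mul_le_mul_right (le_lintegral_occupationTime_pow hB hc hm hε 1 p) _
  · rw [← lintegral_Ioc_kernelPow_zero, ← hcancel ((p + 1).factorial * _)]
    exact mul_le_mul_right (lintegral_occupationTime_pow_le hB hc hm ε 1 p) _

/-- The rescaled path `t ↦ W (T t) / √T` is again a Brownian motion, so the case `T = 1` applies
with width `ε / √T`. -/
lemma lintegral_relativeTime_pow_bounds (hW : IsBrownianReal W P) {ε T : ℝ} (hε : 0 < ε)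
    (hT : 0 < T) (p : ℕ) :
    (p + 1).factorial * ∫⁻ s in Set.Ioc 0 1, kernelPow (ε / √T) p s ≤
        ∫⁻ ω, ENNReal.ofReal (relativeTime (W · ω) ε T ^ (p + 1)) ∂P ∧
      ∫⁻ ω, ENNReal.ofReal (relativeTime (W · ω) ε T ^ (p + 1)) ∂P ≤
        ENNReal.ofReal (limitMoment (p + 1)) := by
  have hsq : 0 < √T := Real.sqrt_pos.2 hT
  simp_rw [relativeTime_eq_relativeTime_one _ ε hT]
  exact lintegral_relativeTime_one_pow_bounds (hW.smul (c := T.toNNReal) (by simpa using hT))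
    (div_pos hε hsq) p

lemma limitMoment_zero : limitMoment 0 = 1 := by
  simp [limitMoment]

lemma limitMoment_nonneg (p : ℕ) : 0 ≤ limitMoment p := by
  have := Real.Gamma_pos_of_pos (by positivity : (0 : ℝ) < p / 2 + 1)
  unfold limitMoment
  positivity

lemma integral_relativeTime_pow_le (hW : IsBrownianReal W P) {ε T : ℝ} (hε : 0 < ε)
    (hT : 0 < T) (p : ℕ) : ∫ ω, relativeTime (W · ω) ε T ^ p ∂P ≤ limitMoment p := by
  cases p with
  | zero => simp [limitMoment_zero]
  | succ p =>
    rw [integral_relativeTime_pow_eq hW hε.le]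
    exact ENNReal.toReal_le_of_le_ofReal (limitMoment_nonneg _)
      (lintegral_relativeTime_pow_bounds hW hε hT p).2

variable {ι : Type*} {l : Filter ι} {ε T : ι → ℝ}

/-- A squeeze in which only `ε / √T → 0` matters; the general filter covers fixed `T` and the joint
limit alike. -/
lemma tendsto_integral_relativeTime_pow (hW : IsBrownianReal W P) (hε : ∀ᶠ i in l, 0 < ε i)
    (hT : ∀ᶠ i in l, 0 < T i) (hlim : Tendsto (fun i ↦ ε i / √(T i)) l (𝓝 0)) (p : ℕ) :
    Tendsto (fun i ↦ ∫ ω, relativeTime (W · ω) (ε i) (T i) ^ p ∂P) l (𝓝 (limitMoment p)) := by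
  cases p with
  | zero => simpa [limitMoment_zero] using tendsto_const_nhds
  | succ p =>
    have hlim' : Tendsto (fun i ↦ ε i / √(T i)) l (𝓝[>] 0) := by
      refine tendsto_nhdsWithin_iff.2 ⟨hlim, ?_⟩
      filter_upwards [hε, hT] with i h1 h2 using div_pos h1 (Real.sqrt_pos.2 h2)
    have hlint : Tendsto
        (fun i ↦ ∫⁻ ω, ENNReal.ofReal (relativeTime (W · ω) (ε i) (T i) ^ (p + 1)) ∂P) l
        (𝓝 (ENNReal.ofReal (limitMoment (p + 1)))) := by
      refine tendsto_of_tendsto_of_tendsto_of_le_of_le'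
        ((tendsto_lintegral_Ioc_kernelPow p).comp hlim') tendsto_const_nhds ?_ ?_
      · filter_upwards [hε, hT] with i h1 h2 using (lintegral_relativeTime_pow_bounds hW h1 h2 p).1
      · filter_upwards [hε, hT] with i h1 h2 using (lintegral_relativeTime_pow_bounds hW h1 h2 p).2
    have hreal := (ENNReal.tendsto_toReal ENNReal.ofReal_ne_top).comp hlint
    rw [ENNReal.toReal_ofReal (limitMoment_nonneg _)] at hreal
    refine hreal.congr' ?_
    filter_upwards [hε] with i hi using (integral_relativeTime_pow_eq hW hi.le _ _).symm

lemma tendstoInDistribution_relativeTime [l.IsCountablyGenerated] (hW : IsBrownianReal W P)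
    (hε : ∀ᶠ i in l, 0 < ε i) (hT : ∀ᶠ i in l, 0 < T i)
    (hlim : Tendsto (fun i ↦ ε i / √(T i)) l (𝓝 0)) :
    TendstoInDistribution (fun i ω ↦ relativeTime (W · ω) (ε i) (T i)) l
      (fun x : ℝ ↦ |x|) (fun _ ↦ P) (gaussianReal 0 1) := by
  refine tendstoInDistribution_of_tendsto_integral_pow
    (fun i ↦ aemeasurable_relativeTime hW _ _) (by fun_prop) ?_ ?_
    integrable_abs_pow_gaussianReal (fun t ↦ ?_) fun p ↦ ?_
  · filter_upwards [hε, hT] with i h1 h2 p using integrable_relativeTime_pow hW p h1.le h2.le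
  · filter_upwards [hε, hT] with i h1 h2 p
    simp_rw [abs_of_nonneg (relativeTime_nonneg _ h1.le _), abs_abs,
      integral_abs_pow_gaussianReal]
    exact integral_relativeTime_pow_le hW h1 h2 p
  · simpa only [abs_abs] using integrable_exp_mul_abs_gaussianReal t
  · rw [integral_abs_pow_gaussianReal]
    exact tendsto_integral_relativeTime_pow hW hε hT hlim p

end RelativeTime

/-! ### The two limiting regimes and the theorem -/

lemma tendsto_div_sqrt_nhdsGT_zero (T : ℝ) :
    Tendsto (fun ε : ℝ ↦ ε / √T) (𝓝[>] 0) (𝓝 0) := by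
  have h : Tendsto (fun ε : ℝ ↦ ε / √T) (𝓝 0) (𝓝 (0 / √T)) := tendsto_id.div_const _
  rw [zero_div] at h
  exact h.mono_left nhdsWithin_le_nhds

lemma tendsto_fst_div_sqrt_snd :
    Tendsto (fun q : ℝ × ℝ ↦ q.1 / √q.2) (𝓝[>] 0 ×ˢ atTop) (𝓝 0) :=
  Tendsto.div_atTop (tendsto_fst.mono_right nhdsWithin_le_nhds)
    (Real.tendsto_sqrt_atTop.comp tendsto_snd)

theorem mainTheorem9 {Ω : Type*} [MeasurableSpace Ω] (P : Measure Ω) [IsProbabilityMeasure P]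
    (W : ℝ≥0 → Ω → ℝ) (hW : IsBrownianReal W P) :
    -- convergence in distribution to `|N(0,1)|` as `ε → 0`, for each fixed `T`
    (∀ T : ℝ, 0 < T →
      TendstoInDistribution (fun (ε : ℝ) (ω : Ω) ↦ relativeTime (W · ω) ε T) (𝓝[>] 0)
        (fun x : ℝ ↦ |x|) (fun _ ↦ P) (gaussianReal 0 1)) ∧
    -- convergence in distribution as `ε → 0` and `T → ∞`
    TendstoInDistribution (fun (q : ℝ × ℝ) (ω : Ω) ↦ relativeTime (W · ω) q.1 q.2)
      (𝓝[>] 0 ×ˢ atTop) (fun x : ℝ ↦ |x|) (fun _ ↦ P) (gaussianReal 0 1) ∧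
    -- all moments exist
    (∀ (p : ℕ) (ε T : ℝ), 0 < ε → 0 < T →
      Integrable (fun ω ↦ relativeTime (W · ω) ε T ^ p) P) ∧
    -- moment convergence as `ε → 0`, for each fixed `T`
    (∀ (p : ℕ) (T : ℝ), 0 < T →
      Tendsto (fun ε : ℝ ↦ ∫ ω, relativeTime (W · ω) ε T ^ p ∂P) (𝓝[>] 0)
        (𝓝 (limitMoment p))) ∧
    -- moment convergence as `ε → 0` and `T → ∞`
    (∀ p : ℕ,
      Tendsto (fun q : ℝ × ℝ ↦ ∫ ω, relativeTime (W · ω) q.1 q.2 ^ p ∂P)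
        (𝓝[>] 0 ×ˢ atTop) (𝓝 (limitMoment p))) ∧
    -- the limits are the moments of `|N(0,1)|`
    (∀ p : ℕ, Integrable (fun x : ℝ ↦ |x| ^ p) (gaussianReal 0 1) ∧
      ∫ x : ℝ, |x| ^ p ∂(gaussianReal 0 1) = limitMoment p) := by
  have hε : ∀ᶠ ε : ℝ in 𝓝[>] 0, 0 < ε := eventually_mem_nhdsWithin
  have hε' : ∀ᶠ q : ℝ × ℝ in 𝓝[>] 0 ×ˢ atTop, 0 < q.1 := tendsto_fst.eventually hε
  have hT' : ∀ᶠ q : ℝ × ℝ in (𝓝[>] 0 : Filter ℝ) ×ˢ atTop, 0 < q.2 :=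
    tendsto_snd.eventually (eventually_gt_atTop 0)
  exact ⟨fun T hT ↦ tendstoInDistribution_relativeTime hW hε (.of_forall fun _ ↦ hT)
      (tendsto_div_sqrt_nhdsGT_zero T),
    tendstoInDistribution_relativeTime hW hε' hT' tendsto_fst_div_sqrt_snd,
    fun p ε T hε hT ↦ integrable_relativeTime_pow hW p hε.le hT.le,
    fun p T hT ↦ tendsto_integral_relativeTime_pow hW hε (.of_forall fun _ ↦ hT)
      (tendsto_div_sqrt_nhdsGT_zero T) p,
    fun p ↦ tendsto_integral_relativeTime_pow hW hε' hT' tendsto_fst_div_sqrt_snd p,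
    fun p ↦ ⟨integrable_abs_pow_gaussianReal p, integral_abs_pow_gaussianReal p⟩⟩
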